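/- Let $d\ge 3$, let $S=\mathbb C[x,y,z]$, and let $f\in S$ be a squarefree homogeneous polynomial of degree $d$, so that $C: f=0$ is a reduced curve of degree $d$ in the complex projective plane. Let $$D_0(f)=\{(a,b,c)\in S^3 : a f_x+b f_y+c f_z=0\}$$ be the graded $S$-module of Jacobian syzygies of $f$, where $(a,b,c)$ is homogeneous of degree $k$ if $a,b,c$ are homogeneous of degree $k$. The curve $C$ is said to be of type $(d,r,m)$ if $D_0(f)$ has a minimal set of homogeneous generators consisting of exactly $m$ syzygies, all of degree $r$. Then $C$ is of type $(d,d-1,3)$ if and only if $C$ is smooth. Moreover, in that case $D_0(f)$ is generated by the three Koszul syzygies $(0,f_z,-f_y)$, $(-f_z,0,f_x)$, $(f_y,-f_x,0)$. -/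

import Mathlib

namespace PlaneCurve

open MvPolynomial

/-- The graded polynomial ring `ℂ[x, y, z]`. -/
abbrev Poly : Type := MvPolynomial (Fin 3) ℂ

/-- The module `D₀(f)` of Jacobian syzygies of `f`: all triples `(a, b, c)` of polynomials with
`a f_x + b f_y + c f_z = 0`. -/
noncomputable def jacobianSyzygies (f : Poly) : Submodule Poly (Fin 3 → Poly) where
  carrier := {ρ | ∑ i, ρ i * pderiv i f = 0}
  zero_mem' := by simp
  add_mem' := by
    intro a b ha hb
    simp only [Set.mem_ofPred_eq] at ha hb ⊢
    simp only [Pi.add_apply, add_mul, Finset.sum_add_distrib, ha, hb, add_zero]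
  smul_mem' := by
    intro c a ha
    simp only [Set.mem_ofPred_eq] at ha ⊢
    simp only [Pi.smul_apply, smul_eq_mul, mul_assoc, ← Finset.mul_sum, ha, mul_zero]

/-- The family `ρ` is a minimal set of homogeneous generators of `D₀(f)`, with `deg ρ_j = e_j`:
the components of `ρ_j` are homogeneous of degree `e_j`, the `ρ_j` generate `D₀(f)` over
`ℂ[x, y, z]`, and none of them lies in the submodule generated by the others. -/
structure IsMinimalGenerators (f : Poly) {m : ℕ} (ρ : Fin m → Fin 3 → Poly)
    (e : Fin m → ℕ) : Prop where
  homogeneous : ∀ j i, (ρ j i).IsHomogeneous (e j)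
  span_eq : Submodule.span Poly (Set.range ρ) = jacobianSyzygies f
  minimal : ∀ j, ρ j ∉ Submodule.span Poly (ρ '' {k | k ≠ j})

/-- The curve `f = 0` is an `m`-syzygy curve with exponents `e_1 ≤ ⋯ ≤ e_m`. -/
def HasExponents (f : Poly) {m : ℕ} (e : Fin m → ℕ) : Prop :=
  Monotone e ∧ ∃ ρ : Fin m → Fin 3 → Poly, IsMinimalGenerators f ρ e

/-- The curve `f = 0` is of type `(d, r, m)`: it has degree `d`, and it is an `m`-syzygy curve
all of whose exponents are equal to `r`. -/
def IsOfType (f : Poly) (d r m : ℕ) : Prop :=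
  f.IsHomogeneous d ∧ HasExponents f (fun _ : Fin m => r)

/-- The projective curve `f = 0` is smooth: at every point of the projective plane that lies on
the curve, given by a nonzero vector of homogeneous coordinates, some first order partial
derivative of `f` does not vanish. -/
def IsSmooth (f : Poly) : Prop :=
  ∀ p : Fin 3 → ℂ, p ≠ 0 → eval p f = 0 → ∃ i, eval p (pderiv i f) ≠ 0

/-- The three Koszul syzygies `(0, f_z, -f_y)`, `(-f_z, 0, f_x)`, `(f_y, -f_x, 0)`. -/
noncomputable def koszulSyzygy (f : Poly) : Fin 3 → Fin 3 → Poly :=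
  ![![0, pderiv 2 f, -pderiv 1 f],
    ![-pderiv 2 f, 0, pderiv 0 f],
    ![pderiv 1 f, -pderiv 0 f, 0]]

/-- The module of Jacobian syzygies is generated by the Koszul syzygies. -/
def IsKoszulGenerated (f : Poly) : Prop :=
  jacobianSyzygies f = Submodule.span Poly (Set.range (koszulSyzygy f))

end PlaneCurve

/-! If the curve is smooth, Euler's formula and the Nullstellensatz put powers of `x`, `y`, `z` in
the Jacobian ideal. They form a regular sequence, so every syzygy is Koszul
(`exists_eq_cross_of_dot_eq_zero`). All syzygies then vanish to order `d - 1` at the origin, so no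
partial derivative is a multiple of another; this gives minimality.

Conversely, three generators of degree `d - 1` span over `ℂ` a space of dimension at most 3. It
contains the independent Koszul syzygies, so these generate too. At a singular point, the height-two
bound on the prime of the corresponding line makes it minimal over `(f_x, f_y)`, hence associated to
it. As `f_z` lies in this prime, some `g` outside `(f_x, f_y)` has `g f_z` inside, which yields a
non-Koszul syzygy. -/

namespace PlaneCurve

open MvPolynomial

/-! ### Koszul relations from a regular sequence -/

section Koszul

variable {R : Type*} [CommRing R] [IsDomain R]

/-- Vectors parallel to `f` are multiples of `f` when the ideal of the entries of `f` contains
`X` and `Y` such that `Y` is regular modulo the nonzero element `X`. -/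
theorem exists_eq_mul_of_cross_eq_zero {X Y : R} (hX : X ≠ 0)
    (hXY : ∀ a b, Y * a = X * b → X ∣ a) {f p q v : Fin 3 → R} (hf : f ≠ 0)
    (hp : X = f 0 * p 0 + f 1 * p 1 + f 2 * p 2) (hq : Y = f 0 * q 0 + f 1 * q 1 + f 2 * q 2)
    (h0 : f 1 * v 2 = f 2 * v 1) (h1 : f 2 * v 0 = f 0 * v 2) (h2 : f 0 * v 1 = f 1 * v 0) :
    ∃ k, ∀ i, v i = k * f i := by
  have key : ∀ u : Fin 3 → R, ∀ i, (f 0 * u 0 + f 1 * u 1 + f 2 * u 2) * v i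
      = (u 0 * v 0 + u 1 * v 1 + u 2 * v 2) * f i := by
    intro u i
    fin_cases i
    · simp only [Fin.zero_eta]
      linear_combination (-u 1) * h2 + u 2 * h1
    · simp only [Fin.mk_one]
      linear_combination (-u 2) * h0 + u 0 * h2
    · simp only [Fin.reduceFinMk]
      linear_combination (-u 0) * h1 + u 1 * h0
  obtain ⟨i, hi⟩ := Function.ne_iff.mp hf
  have hi' : f i ≠ 0 := hi
  have hP := fun j => key p j
  have hQ := fun j => key q j
  rw [← hp] at hP
  rw [← hq] at hQ
  -- Here `X v = (p·v) f` and `Y v = (q·v) f`, so `Y (p·v) = X (q·v)`.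
  obtain ⟨k, hk⟩ := hXY (p 0 * v 0 + p 1 * v 1 + p 2 * v 2) (q 0 * v 0 + q 1 * v 1 + q 2 * v 2)
    (mul_right_cancel₀ hi' (by linear_combination X * hQ i - Y * hP i))
  refine ⟨k, fun j => mul_left_cancel₀ hX ?_⟩
  rw [hP j, hk]
  ring

/-- If the ideal of the entries of `f` contains a regular sequence `X, Y, Z`, then all relations
between the entries of `f` are Koszul relations. -/
theorem exists_eq_cross_of_dot_eq_zero {X Y Z : R} (hX : X ≠ 0)
    (hXY : ∀ a b, Y * a = X * b → X ∣ a)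
    (hXYZ : ∀ a b c, X * a + Y * b + Z * c = 0 → ∃ u v, c = X * u + Y * v)
    {f p q s r : Fin 3 → R}
    (hp : X = f 0 * p 0 + f 1 * p 1 + f 2 * p 2) (hq : Y = f 0 * q 0 + f 1 * q 1 + f 2 * q 2)
    (hs : Z = f 0 * s 0 + f 1 * s 1 + f 2 * s 2)
    (hr : r 0 * f 0 + r 1 * f 1 + r 2 * f 2 = 0) :
    ∃ k : Fin 3 → R, r 0 = f 1 * k 2 - f 2 * k 1 ∧ r 1 = f 2 * k 0 - f 0 * k 2 ∧
      r 2 = f 0 * k 1 - f 1 * k 0 := by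
  have hf : f ≠ 0 := by
    rintro rfl
    exact hX (by simpa using hp)
  -- The cross product `r × u`.
  let cr : (Fin 3 → R) → Fin 3 → R := fun u =>
    ![r 1 * u 2 - r 2 * u 1, r 2 * u 0 - r 0 * u 2, r 0 * u 1 - r 1 * u 0]
  -- Both `r` and `V u - U v` are orthogonal to `f`, so their cross product is parallel to `f`.
  have hpar : ∀ (U V : R) (u v : Fin 3 → R), U = f 0 * u 0 + f 1 * u 1 + f 2 * u 2 →
      V = f 0 * v 0 + f 1 * v 1 + f 2 * v 2 → ∃ k, ∀ i, V * cr u i - U * cr v i = k * f i := by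
    intro U V u v hU hV
    refine exists_eq_mul_of_cross_eq_zero (v := fun i => V * cr u i - U * cr v i)
      hX hXY hf hp hq ?_ ?_ ?_ <;>
    simp only [cr, Matrix.cons_val, hU, hV]
    · linear_combination ((f 0 * u 0 + f 1 * u 1 + f 2 * u 2) * v 0
        - (f 0 * v 0 + f 1 * v 1 + f 2 * v 2) * u 0) * hr
    · linear_combination ((f 0 * u 0 + f 1 * u 1 + f 2 * u 2) * v 1
        - (f 0 * v 0 + f 1 * v 1 + f 2 * v 2) * u 1) * hr
    · linear_combination ((f 0 * u 0 + f 1 * u 1 + f 2 * u 2) * v 2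
        - (f 0 * v 0 + f 1 * v 1 + f 2 * v 2) * u 2) * hr
  obtain ⟨h3, H3⟩ := hpar X Y p q hp hq
  obtain ⟨h1, H1⟩ := hpar Y Z q s hq hs
  obtain ⟨h2, H2⟩ := hpar Z X s p hs hp
  obtain ⟨i, hi⟩ := Function.ne_iff.mp hf
  have hi' : f i ≠ 0 := hi
  have hsum : X * h1 + Y * h2 + Z * h3 = 0 := by
    refine (mul_eq_zero.mp ?_).resolve_right hi'
    linear_combination -X * H1 i - Y * H2 i - Z * H3 i
  -- Writing `h3 = X w2 + Y w1` lets `r × p` be corrected by a multiple of `f` to become `X k`. Then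
  -- `X (f × k) = f × (r × p) = X r`, since `f·r = 0`.
  obtain ⟨w2, w1, hw⟩ := hXYZ _ _ _ hsum
  choose k hk using fun i => hXY (cr p i - w1 * f i) (cr q i + w2 * f i)
    (by linear_combination H3 i + f i * hw)
  have k0 := hk 0
  have k1 := hk 1
  have k2 := hk 2
  simp only [cr, Matrix.cons_val] at k0 k1 k2
  refine ⟨k, mul_left_cancel₀ hX ?_, mul_left_cancel₀ hX ?_, mul_left_cancel₀ hX ?_⟩
  · linear_combination f 1 * k2 - f 2 * k1 + r 0 * hp + p 0 * hr
  · linear_combination f 2 * k0 - f 0 * k2 + r 1 * hp + p 1 * hr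
  · linear_combination f 0 * k1 - f 1 * k0 + r 2 * hp + p 2 * hr

end Koszul

theorem X_pow_dvd_of_mul_eq {σ : Type*} {i j : σ} (hij : i ≠ j) (m n : ℕ)
    (a b : MvPolynomial σ ℂ) (h : X j ^ n * a = X i ^ m * b) : X i ^ m ∣ a := by
  refine X_prime.pow_dvd_of_dvd_mul_left m (fun hd => hij ?_) ⟨b, h⟩
  exact X_dvd_X.mp (X_prime.dvd_of_dvd_pow hd)

/-- Membership in a monomial ideal is tested on each exponent, and multiplying by a power of `X k`
does not change the exponents of `X i` and `X j`. -/
theorem exists_eq_X_pow_combination {σ : Type*} {i j k : σ} (hik : i ≠ k) (hjk : j ≠ k)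
    (l m n : ℕ) (a b c : MvPolynomial σ ℂ)
    (h : X i ^ l * a + X j ^ m * b + X k ^ n * c = 0) :
    ∃ u v, c = X i ^ l * u + X j ^ m * v := by
  classical
  have hspan : ∀ p : MvPolynomial σ ℂ, p ∈ Ideal.span {X i ^ l, X j ^ m} ↔
      ∀ x ∈ p.support, ∃ s ∈ ({Finsupp.single i l, Finsupp.single j m} : Set (σ →₀ ℕ)),
        s ≤ x := by
    intro p
    rw [← mem_ideal_span_monomial_image, Set.image_pair, ← X_pow_eq_monomial, ← X_pow_eq_monomial]
  have hmem : c * X k ^ n ∈ Ideal.span {X i ^ l, X j ^ m} :=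
    Ideal.mem_span_pair.mpr ⟨-a, -b, by linear_combination -h⟩
  have hc : c ∈ Ideal.span {X i ^ l, X j ^ m} := by
    rw [hspan] at hmem ⊢
    intro x hx
    obtain ⟨s, hs, hsx⟩ := hmem (x + Finsupp.single k n) (by
      rw [mem_support_iff] at hx ⊢
      rwa [X_pow_eq_monomial, coeff_mul_monomial, mul_one])
    refine ⟨s, hs, ?_⟩
    rcases hs with rfl | rfl
    · have := hsx i
      simpa [Finsupp.single_le_iff, hik, hik.symm] using this
    · have := hsx j
      simpa [Finsupp.single_le_iff, hjk, hjk.symm] using this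
  obtain ⟨u, v, huv⟩ := Ideal.mem_span_pair.mp hc
  exact ⟨u, v, by rw [← huv]; ring⟩

/-! ### Smooth curves have only Koszul syzygies -/

theorem mem_jacobianSyzygies {f : Poly} {ρ : Fin 3 → Poly} :
    ρ ∈ jacobianSyzygies f ↔
      ρ 0 * pderiv 0 f + ρ 1 * pderiv 1 f + ρ 2 * pderiv 2 f = 0 := by
  rw [← Fin.sum_univ_three (fun i => ρ i * pderiv i f)]
  rfl

theorem mem_span_koszulSyzygy {f : Poly} {ρ : Fin 3 → Poly} :
    ρ ∈ Submodule.span Poly (Set.range (koszulSyzygy f)) ↔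
      ∃ k : Fin 3 → Poly, ρ 0 = pderiv 1 f * k 2 - pderiv 2 f * k 1 ∧
        ρ 1 = pderiv 2 f * k 0 - pderiv 0 f * k 2 ∧
        ρ 2 = pderiv 0 f * k 1 - pderiv 1 f * k 0 := by
  rw [Submodule.mem_span_range_iff_exists_fun]
  refine exists_congr fun k => ?_
  rw [funext_iff, Fin.forall_fin_succ, Fin.forall_fin_two, Fin.sum_univ_three]
  simp only [koszulSyzygy, Pi.add_apply, Pi.smul_apply, smul_eq_mul, Matrix.cons_val,
    Fin.succ_zero_eq_one, Fin.succ_one_eq_two]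
  refine and_congr ?_ (and_congr ?_ ?_) <;>
    constructor <;> intro h <;> linear_combination -h

theorem span_koszulSyzygy_le (f : Poly) :
    Submodule.span Poly (Set.range (koszulSyzygy f)) ≤ jacobianSyzygies f := by
  intro ρ hρ
  obtain ⟨k, h0, h1, h2⟩ := mem_span_koszulSyzygy.mp hρ
  rw [mem_jacobianSyzygies, h0, h1, h2]
  ring

theorem eq_zero_of_eval_pderiv_eq_zero {d : ℕ} (hd : d ≠ 0) {f : Poly} (hf : f.IsHomogeneous d)
    (hs : IsSmooth f) {p : Fin 3 → ℂ} (hp : ∀ i, eval p (pderiv i f) = 0) : p = 0 := by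
  by_contra hne
  have heuler := congrArg (eval p) hf.sum_X_mul_pderiv
  simp only [map_sum, map_mul, hp, mul_zero, Finset.sum_const_zero, map_nsmul] at heuler
  obtain ⟨i, hi⟩ := hs p hne ((smul_eq_zero.mp heuler.symm).resolve_left hd)
  exact hi (hp i)

theorem exists_X_pow_eq_of_isSmooth {d : ℕ} (hd : d ≠ 0) {f : Poly} (hf : f.IsHomogeneous d)
    (hs : IsSmooth f) (j : Fin 3) : ∃ n : ℕ, ∃ p : Fin 3 → Poly, (X j : Poly) ^ n =
      pderiv 0 f * p 0 + pderiv 1 f * p 1 + pderiv 2 f * p 2 := by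
  have hmem : (X j : Poly) ∈ (Ideal.span (Set.range fun i => pderiv i f)).radical := by
    rw [← vanishingIdeal_zeroLocus_eq_radical (K := ℂ)]
    intro p hp
    have : p = 0 := eq_zero_of_eval_pderiv_eq_zero hd hf hs fun i =>
      hp _ (Ideal.subset_span ⟨i, rfl⟩)
    simp [this]
  obtain ⟨n, hn⟩ := hmem
  obtain ⟨p, hp⟩ := (Ideal.mem_span_range_iff_exists_fun).mp hn
  refine ⟨n, p, ?_⟩
  rw [← hp, Fin.sum_univ_three]
  ring

theorem isKoszulGenerated_of_isSmooth {d : ℕ} (hd : d ≠ 0) {f : Poly} (hf : f.IsHomogeneous d)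
    (hs : IsSmooth f) : IsKoszulGenerated f := by
  refine le_antisymm (fun ρ hρ => ?_) (span_koszulSyzygy_le f)
  obtain ⟨l, p, hp⟩ := exists_X_pow_eq_of_isSmooth hd hf hs 0
  obtain ⟨m, q, hq⟩ := exists_X_pow_eq_of_isSmooth hd hf hs 1
  obtain ⟨n, s, hs⟩ := exists_X_pow_eq_of_isSmooth hd hf hs 2
  exact mem_span_koszulSyzygy.mpr <| exists_eq_cross_of_dot_eq_zero
    (f := fun i => pderiv i f) (pow_ne_zero l (X_ne_zero 0))
    (X_pow_dvd_of_mul_eq (by decide) l m)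
    (exists_eq_X_pow_combination (by decide) (by decide) l m n) hp hq hs
    (mem_jacobianSyzygies.mp hρ)

theorem isHomogeneous_koszulSyzygy {d : ℕ} {f : Poly} (hf : f.IsHomogeneous d) (j i : Fin 3) :
    (koszulSyzygy f j i).IsHomogeneous (d - 1) := by
  have h := fun i : Fin 3 => hf.pderiv (i := i)
  fin_cases j <;> fin_cases i <;>
    simp [koszulSyzygy, isHomogeneous_zero, h, (h _).neg]

/-! ### Order of vanishing and minimality -/

theorem apply_mem_of_mem_span {R : Type*} [CommRing R] {ι : Type*} {s : Set (ι → R)}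
    {I : Ideal R} (hs : ∀ v ∈ s, ∀ i, v i ∈ I) {v : ι → R} (hv : v ∈ Submodule.span R s) (i : ι) :
    v i ∈ I := by
  have hle : Submodule.span R s ≤ Submodule.pi Set.univ fun _ => I :=
    Submodule.span_le.mpr fun v hv i _ => hs v hv i
  exact hle hv i trivial

theorem mem_pow_idealOfVars_of_isHomogeneous {σ : Type*} {n : ℕ} {p : MvPolynomial σ ℂ}
    (hp : p.IsHomogeneous n) : p ∈ idealOfVars σ ℂ ^ n :=
  (mem_pow_idealOfVars_iff' n p).mpr fun _ hx => hp.coeff_eq_zero hx.ne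

theorem le_totalDegree_of_mem_pow_idealOfVars {σ : Type*} {n : ℕ} {p : MvPolynomial σ ℂ}
    (hp : p ∈ idealOfVars σ ℂ ^ n) (h0 : p ≠ 0) : n ≤ p.totalDegree := by
  obtain ⟨x, hx⟩ := support_nonempty.mpr h0
  exact ((mem_pow_idealOfVars_iff n p).mp hp x hx).trans
    (le_totalDegree hx)

/-- The entries of a syzygy vanish to order `n` at the origin when the syzygies are generated by
homogeneous ones of degree `n`. -/
theorem mem_pow_idealOfVars_of_span_eq {f : Poly} {n m : ℕ} {ρ : Fin m → Fin 3 → Poly}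
    (hρ : ∀ j i, (ρ j i).IsHomogeneous n)
    (hspan : Submodule.span Poly (Set.range ρ) = jacobianSyzygies f)
    {v : Fin 3 → Poly} (hv : v ∈ jacobianSyzygies f) (i : Fin 3) :
    v i ∈ idealOfVars (Fin 3) ℂ ^ n := by
  refine apply_mem_of_mem_span (s := Set.range ρ) ?_ (hspan ▸ hv) i
  rintro _ ⟨j, rfl⟩ i
  exact mem_pow_idealOfVars_of_isHomogeneous (hρ j i)

/-- The syzygies of `f` have no constant entry. -/
def HasNoConstantSyzygy (f : Poly) : Prop :=
  ∀ v ∈ jacobianSyzygies f, ∀ i (c : ℂ), v i = C c → c = 0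

theorem hasNoConstantSyzygy_of_span_eq {f : Poly} {n m : ℕ} (hn : n ≠ 0)
    {ρ : Fin m → Fin 3 → Poly} (hρ : ∀ j i, (ρ j i).IsHomogeneous n)
    (hspan : Submodule.span Poly (Set.range ρ) = jacobianSyzygies f) : HasNoConstantSyzygy f := by
  intro v hv i c hc
  have := mem_pow_idealOfVars_of_span_eq hρ hspan hv i
  rw [hc, C_mem_pow_idealOfVars_iff] at this
  exact this.resolve_right hn

/-- A relation `f_i = b f_j` would be a syzygy with an entry equal to 1. -/
theorem HasNoConstantSyzygy.pderiv_notMem_span {f : Poly} (h : HasNoConstantSyzygy f)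
    {i j : Fin 3} (hij : i ≠ j) : pderiv i f ∉ Ideal.span {pderiv j f} := by
  intro hmem
  obtain ⟨b, hb⟩ := Ideal.mem_span_singleton'.mp hmem
  let v : Fin 3 → Poly := fun l => if l = i then 1 else if l = j then -b else 0
  have hvi : v i = 1 := if_pos rfl
  have hvj : v j = -b := by simp only [v, hij.symm, if_false, if_true]
  have hv : v ∈ jacobianSyzygies f := by
    change ∑ l, v l * pderiv l f = 0
    rw [Fintype.sum_eq_add i j hij, hvi, hvj, ← hb]
    · ring
    · rintro l ⟨hli, hlj⟩
      simp only [v, hli, hlj, if_false, zero_mul]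
  exact one_ne_zero (h v hv i 1 (by rw [hvi, C_1]))

theorem isOfType_of_isSmooth {d : ℕ} (hd : 2 ≤ d) {f : Poly} (hf : f.IsHomogeneous d)
    (hs : IsSmooth f) : IsOfType f d (d - 1) 3 := by
  have hk : IsKoszulGenerated f := isKoszulGenerated_of_isSmooth (by omega) hf hs
  have hc : HasNoConstantSyzygy f :=
    hasNoConstantSyzygy_of_span_eq (by omega) (isHomogeneous_koszulSyzygy hf) hk.symm
  refine ⟨hf, monotone_const, koszulSyzygy f, isHomogeneous_koszulSyzygy hf, hk.symm, ?_⟩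
  -- Project to a coordinate where the `j`-th syzygy has one partial derivative up to sign, while
  -- the others have zero or another partial, which generates `I`.
  have aux : ∀ (j i : Fin 3) (I : Ideal Poly), koszulSyzygy f j i ∉ I →
      (∀ k ≠ j, koszulSyzygy f k i ∈ I) →
      koszulSyzygy f j ∉ Submodule.span Poly (koszulSyzygy f '' {k | k ≠ j}) := by
    intro j i I hj hI hmem
    have hle : Submodule.span Poly (koszulSyzygy f '' {k | k ≠ j}) ≤
        Submodule.comap (LinearMap.proj (R := Poly) (φ := fun _ : Fin 3 => Poly) i) I := by
      rw [Submodule.span_le]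
      rintro _ ⟨k, hk, rfl⟩
      exact hI k hk
    exact hj (hle hmem)
  intro j
  fin_cases j
  · refine aux 0 1 (Ideal.span {pderiv 0 f}) ?_ fun k hk => ?_
    · simpa [koszulSyzygy] using hc.pderiv_notMem_span (i := 2) (j := 0) (by decide)
    · fin_cases k <;> simp_all [koszulSyzygy]
  · refine aux 1 0 (Ideal.span {pderiv 1 f}) ?_ fun k hk => ?_
    · simpa [koszulSyzygy] using hc.pderiv_notMem_span (i := 2) (j := 1) (by decide)
    · fin_cases k <;> simp_all [koszulSyzygy]
  · refine aux 2 0 (Ideal.span {pderiv 2 f}) ?_ fun k hk => ?_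
    · simpa [koszulSyzygy] using hc.pderiv_notMem_span (i := 1) (j := 2) (by decide)
    · fin_cases k <;> simp_all [koszulSyzygy]

/-! ### From three generators of degree `d - 1` to the Koszul syzygies -/

theorem linearIndependent_koszulSyzygy {f : Poly} (hc : HasNoConstantSyzygy f) :
    LinearIndependent ℂ (koszulSyzygy f) := by
  rw [Fintype.linearIndependent_iff]
  intro α hα
  have h0 := congrFun hα 0
  have h1 := congrFun hα 1
  simp only [Fin.sum_univ_three, koszulSyzygy, Pi.add_apply, Pi.smul_apply, Matrix.cons_val,
    smul_eq_C_mul, Pi.zero_apply] at h0 h1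
  -- Each coordinate of a constant relation is itself a syzygy with constant entries.
  have hv : (![0, C (α 2), -C (α 1)] : Fin 3 → Poly) ∈ jacobianSyzygies f := by
    rw [mem_jacobianSyzygies]
    simp only [Matrix.cons_val]
    linear_combination h0
  have hw : (![-C (α 2), 0, C (α 0)] : Fin 3 → Poly) ∈ jacobianSyzygies f := by
    rw [mem_jacobianSyzygies]
    simp only [Matrix.cons_val]
    linear_combination h1
  intro i
  fin_cases i
  · exact hc _ hw 2 _ rfl
  · exact neg_eq_zero.mp (hc _ hv 2 (-α 1) (C_neg (σ := Fin 3) (α 1)).symm)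
  · exact hc _ hv 1 _ rfl

/-- A homogeneous vector of degree `n` in the module generated by homogeneous vectors of
degree `n` is a combination of them with constant coefficients. -/
theorem mem_span_complex_of_mem_span {σ ι κ : Type*} [Fintype κ] {n : ℕ}
    {ρ : κ → ι → MvPolynomial σ ℂ} (hρ : ∀ j i, (ρ j i).IsHomogeneous n)
    {v : ι → MvPolynomial σ ℂ} (hv : ∀ i, (v i).IsHomogeneous n)
    (hmem : v ∈ Submodule.span (MvPolynomial σ ℂ) (Set.range ρ)) :
    v ∈ Submodule.span ℂ (Set.range ρ) := by
  obtain ⟨a, rfl⟩ := (Submodule.mem_span_range_iff_exists_fun _).mp hmem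
  refine (Submodule.mem_span_range_iff_exists_fun _).mpr ⟨fun j => constantCoeff (a j), ?_⟩
  funext i
  -- The difference has order at least `n + 1` but is homogeneous of degree `n`, so it vanishes.
  have hdiff : (∑ j, a j • ρ j) i - (∑ j, constantCoeff (a j) • ρ j) i
      ∈ idealOfVars σ ℂ ^ (n + 1) := by
    simp only [Finset.sum_apply, Pi.smul_apply, smul_eq_mul, smul_eq_C_mul,
      ← Finset.sum_sub_distrib, ← sub_mul]
    refine Ideal.sum_mem _ fun j _ => ?_
    rw [pow_succ']
    refine Ideal.mul_mem_mul ?_ (mem_pow_idealOfVars_of_isHomogeneous (hρ j i))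
    rw [← pow_one (idealOfVars σ ℂ), mem_pow_idealOfVars_iff']
    intro x hx
    rw [Nat.lt_one_iff, Finsupp.degree_eq_zero_iff] at hx
    simp [hx, constantCoeff_eq]
  have hhom : ((∑ j, a j • ρ j) i - (∑ j, constantCoeff (a j) • ρ j) i).IsHomogeneous n := by
    refine (hv i).sub ?_
    simp only [Finset.sum_apply, Pi.smul_apply, smul_eq_C_mul]
    exact IsHomogeneous.sum _ _ _ fun j _ => (hρ j i).C_mul _
  by_contra hne
  have h0 := sub_ne_zero.mpr (Ne.symm hne)
  have := le_totalDegree_of_mem_pow_idealOfVars hdiff h0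
  rw [hhom.totalDegree h0] at this
  omega

theorem isKoszulGenerated_of_isMinimalGenerators {d : ℕ} (hd : 2 ≤ d) {f : Poly}
    (hf : f.IsHomogeneous d) {ρ : Fin 3 → Fin 3 → Poly}
    (hρ : ∀ j i, (ρ j i).IsHomogeneous (d - 1))
    (hspan : Submodule.span Poly (Set.range ρ) = jacobianSyzygies f) : IsKoszulGenerated f := by
  have hc := hasNoConstantSyzygy_of_span_eq (by omega) hρ hspan
  have hle : Submodule.span ℂ (Set.range (koszulSyzygy f)) ≤ Submodule.span ℂ (Set.range ρ) := by
    rw [Submodule.span_le]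
    rintro _ ⟨j, rfl⟩
    refine mem_span_complex_of_mem_span hρ (isHomogeneous_koszulSyzygy hf j) ?_
    rw [hspan]
    exact span_koszulSyzygy_le f (Submodule.subset_span ⟨j, rfl⟩)
  have := FiniteDimensional.span_of_finite ℂ (Set.finite_range ρ)
  have heq := Submodule.eq_of_le_of_finrank_le hle (by
    rw [finrank_span_eq_card (linearIndependent_koszulSyzygy hc)]
    exact finrank_range_le_card ρ)
  refine le_antisymm ?_ (span_koszulSyzygy_le f)
  rw [← hspan, Submodule.span_le]
  rintro _ ⟨j, rfl⟩
  have hj : ρ j ∈ Submodule.span ℂ (Set.range (koszulSyzygy f)) :=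
    heq ▸ Submodule.subset_span ⟨j, rfl⟩
  exact Submodule.span_le_restrictScalars ℂ Poly _ hj

/-! ### Singular points and non-Koszul syzygies -/

/-- The kernel of the restriction of polynomials to the line through the origin and `p`. -/
noncomputable def lineIdeal {σ : Type*} (p : σ → ℂ) : Ideal (MvPolynomial σ ℂ) :=
  RingHom.ker (aeval fun i => Polynomial.C (p i) * Polynomial.X :
    MvPolynomial σ ℂ →ₐ[ℂ] Polynomial ℂ)

instance {σ : Type*} (p : σ → ℂ) : (lineIdeal p).IsPrime :=
  RingHom.ker_isPrime _

/-- On the line, `g(tp) = g(p) t ^ n`. -/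
theorem mem_lineIdeal_of_isHomogeneous {σ : Type*} {p : σ → ℂ} {n : ℕ} {g : MvPolynomial σ ℂ}
    (hg : g.IsHomogeneous n) (h : eval p g = 0) : g ∈ lineIdeal p := by
  have key : aeval (fun i => Polynomial.C (p i) * Polynomial.X) g =
      Polynomial.C (eval p g) * Polynomial.X ^ n := by
    rw [aeval_def, eval₂_eq, eval_eq, map_sum, Finset.sum_mul]
    refine Finset.sum_congr rfl fun x hx => ?_
    rw [map_mul, map_prod, hg.degree_eq_sum_deg_support hx, ← Finset.prod_pow_eq_pow_sum,
      mul_assoc, ← Finset.prod_mul_distrib]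
    simp only [mul_pow, map_pow]
    rfl
  rw [lineIdeal, RingHom.mem_ker, key, h, map_zero, zero_mul]

theorem lineIdeal_lt_ker_constantCoeff {σ : Type*} {p : σ → ℂ} (hp : p ≠ 0) :
    lineIdeal p < RingHom.ker (constantCoeff : MvPolynomial σ ℂ →+* ℂ) := by
  refine lt_of_le_of_ne (fun g hg => ?_) fun heq => ?_
  · have h := congrArg (Polynomial.eval 0) (RingHom.mem_ker.mp hg)
    rw [← Polynomial.coe_evalRingHom, aeval_def, hom_eval₂] at h
    simp only [Polynomial.coe_evalRingHom, Polynomial.eval_mul,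
      Polynomial.eval_X, mul_zero, Polynomial.eval_zero] at h
    have hid : (Polynomial.evalRingHom 0).comp (algebraMap ℂ (Polynomial ℂ)) = RingHom.id ℂ := by
      ext; simp
    rw [hid] at h
    rw [RingHom.mem_ker, ← eval_zero']
    exact h
  · obtain ⟨i, hi⟩ := Function.ne_iff.mp hp
    have : (X i : MvPolynomial σ ℂ) ∈ lineIdeal p := by
      rw [heq, RingHom.mem_ker, constantCoeff_X]
    rw [lineIdeal, RingHom.mem_ker, aeval_X, mul_eq_zero] at this
    exact this.elim (fun h => hi (Polynomial.C_eq_zero.mp h)) Polynomial.X_ne_zero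

theorem height_lineIdeal_le {p : Fin 3 → ℂ} (hp : p ≠ 0) : (lineIdeal p).height ≤ 2 := by
  have hprime : (RingHom.ker (constantCoeff : Poly →+* ℂ)).IsPrime := RingHom.ker_isPrime _
  have h1 := Ideal.height_add_one_le_of_lt_of_isPrime (lineIdeal_lt_ker_constantCoeff hp)
  have h2 : ((RingHom.ker (constantCoeff : Poly →+* ℂ)).height : WithBot ℕ∞) ≤ 3 := by
    refine Ideal.height_le_ringKrullDim_of_isPrime.trans ?_
    rw [ringKrullDim_of_isNoetherianRing, ringKrullDim_eq_zero_of_field]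
    simp
  have h3 : (lineIdeal p).height + 1 ≤ 2 + 1 := h1.trans (WithBot.coe_le_coe.mp h2)
  exact (ENat.add_le_add_iff_right (by simp)).mp h3

/-- A prime ideal of height at most two containing two coprime elements of a factorial ring is
minimal over the ideal generated by them. -/
theorem mem_minimalPrimes_span_pair {R : Type*} [CommRing R] [IsDomain R]
    [UniqueFactorizationMonoid R] {a b : R} (ha : a ≠ 0) (hab : IsRelPrime a b) {P : Ideal R}
    [hP : P.IsPrime] (haP : a ∈ P) (hbP : b ∈ P) (hh : P.height ≤ 2) :
    P ∈ (Ideal.span {a, b}).minimalPrimes := by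
  have hle : Ideal.span {a, b} ≤ P := Ideal.span_le.mpr (by
    rintro _ (rfl | rfl) <;> assumption)
  obtain ⟨Q, hQ, hQP⟩ := Ideal.exists_minimalPrimes_le hle
  have hQprime : Q.IsPrime := hQ.1.1
  rcases hQP.eq_or_lt with rfl | hlt
  · exact hQ
  exfalso
  have haQ : a ∈ Q := hQ.1.2 (Ideal.subset_span (by simp))
  have hbQ : b ∈ Q := hQ.1.2 (Ideal.subset_span (by simp))
  -- The chain `0 < (q) < Q < P` would force height at least 3; coprimality makes `(q) < Q` strict.
  obtain ⟨q, hqQ, hq⟩ := hQprime.exists_mem_prime_of_ne_bot fun h => ha (by simpa [h] using haQ)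
  have hqprime : (Ideal.span {q}).IsPrime := (Ideal.span_singleton_prime hq.ne_zero).mpr hq
  have hlt1 : ⊥ < Ideal.span {q} := by
    rw [bot_lt_iff_ne_bot, Ne, Ideal.span_singleton_eq_bot]
    exact hq.ne_zero
  have hlt2 : Ideal.span {q} < Q := by
    refine lt_of_le_of_ne ((Ideal.span_singleton_le_iff_mem _).mpr hqQ) ?_
    rintro rfl
    exact hq.not_isUnit (hab (Ideal.mem_span_singleton.mp haQ)
      (Ideal.mem_span_singleton.mp hbQ))
  have h1 := Ideal.height_add_one_le_of_lt_of_isPrime hlt1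
  have h2 := Ideal.height_add_one_le_of_lt_of_isPrime hlt2
  have h3 := Ideal.height_add_one_le_of_lt_of_isPrime hlt
  rw [Ideal.height_bot, zero_add] at h1
  have : (3 : ℕ∞) ≤ 2 := by
    calc (3 : ℕ∞) = 1 + 1 + 1 := by norm_num
      _ ≤ Q.height + 1 := by gcongr; exact (add_le_add_left h1 1).trans h2
      _ ≤ 2 := h3.trans hh
  exact absurd this (by decide)

/-- A minimal prime over `I` is associated to `R ⧸ I`, so it annihilates a nonzero class. -/
theorem exists_notMem_forall_mul_mem_of_mem_minimalPrimes {R : Type*} [CommRing R]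
    [IsNoetherianRing R] {I P : Ideal R} (hP : P ∈ I.minimalPrimes) :
    ∃ g ∉ I, ∀ c ∈ P, c * g ∈ I := by
  have hass : P ∈ associatedPrimes R (R ⧸ I) :=
    Module.associatedPrimes.minimalPrimes_annihilator_subset_associatedPrimes R (R ⧸ I)
      (by rwa [Ideal.annihilator_quotient])
  obtain ⟨hprime, x, hx⟩ := isAssociatedPrime_iff.mp hass
  obtain ⟨g, rfl⟩ := Ideal.Quotient.mk_surjective x
  have key : ∀ c, c ∈ P ↔ c * g ∈ I := by
    intro c
    rw [hx, Submodule.mem_colon_singleton, Submodule.mem_bot, ← Ideal.Quotient.eq_zero_iff_mem]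
    rfl
  refine ⟨g, fun hg => hprime.ne_top ?_, fun c => (key c).mp⟩
  rw [Ideal.eq_top_iff_one, key, one_mul]
  exact hg

theorem isSmooth_of_isKoszulGenerated {d : ℕ} (hd : 2 ≤ d) {f : Poly} (hf : f.IsHomogeneous d)
    (hk : IsKoszulGenerated f) (hD : ∀ v ∈ jacobianSyzygies f, ∀ i,
      v i ∈ idealOfVars (Fin 3) ℂ ^ (d - 1)) : IsSmooth f := by
  intro p hp _
  by_contra! hsing
  have hmem : ∀ i, pderiv i f ∈ lineIdeal p := fun i =>
    mem_lineIdeal_of_isHomogeneous hf.pderiv (hsing i)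
  have h0 : pderiv 0 f ≠ 0 := by
    intro h0
    have hv : (![1, 0, 0] : Fin 3 → Poly) ∈ jacobianSyzygies f := by
      rw [mem_jacobianSyzygies]
      simp [h0]
    have := (C_mem_pow_idealOfVars_iff (σ := Fin 3) (d - 1) (1 : ℂ)).mp
      (by simpa using hD _ hv 0)
    simp at this
    omega
  -- Cancelling a common factor `q` leaves the syzygy `(v, -u, 0)`; its order is at least `d - 1`,
  -- so `q` is constant.
  have hrel : IsRelPrime (pderiv 0 f) (pderiv 1 f) := by
    rintro q ⟨u, hu⟩ ⟨v, hv⟩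
    have hmemD : (![v, -u, 0] : Fin 3 → Poly) ∈ jacobianSyzygies f := by
      rw [mem_jacobianSyzygies]
      simp only [Matrix.cons_val, hu, hv]
      ring
    have hq0 : q ≠ 0 := left_ne_zero_of_mul (hu ▸ h0)
    have hu0 : u ≠ 0 := right_ne_zero_of_mul (hu ▸ h0)
    have hdeg : d - 1 ≤ u.totalDegree :=
      le_totalDegree_of_mem_pow_idealOfVars (by simpa using hD _ hmemD 1) hu0
    have htot := (hf.pderiv (i := (0 : Fin 3))).totalDegree h0
    rw [hu, totalDegree_mul_of_isDomain hq0 hu0] at htot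
    have hqC := (totalDegree_eq_zero_iff_eq_C (p := q)).mp (by omega)
    rw [hqC] at hq0 ⊢
    exact (isUnit_iff_ne_zero.mpr fun h => hq0 (by rw [h, C_0])).map C
  obtain ⟨g, hg, hgP⟩ := exists_notMem_forall_mul_mem_of_mem_minimalPrimes
    (mem_minimalPrimes_span_pair h0 hrel (hmem 0) (hmem 1) (height_lineIdeal_le hp))
  obtain ⟨a, b, hab⟩ := Ideal.mem_span_pair.mp (hgP _ (hmem 2))
  have hv : (![a, b, -g] : Fin 3 → Poly) ∈ jacobianSyzygies f := by
    rw [mem_jacobianSyzygies]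
    simp only [Matrix.cons_val]
    linear_combination hab
  rw [hk] at hv
  -- The third entry of a Koszul combination lies in `(f_x, f_y)`, but `-g` does not.
  obtain ⟨k, -, -, h2⟩ := mem_span_koszulSyzygy.mp hv
  simp only [Matrix.cons_val] at h2
  exact hg (Ideal.mem_span_pair.mpr ⟨-k 1, k 0, by linear_combination h2⟩)

end PlaneCurve

theorem mainTheorem6 (d : ℕ) (hd : 3 ≤ d) (f : MvPolynomial (Fin 3) ℂ)
    (hf : f.IsHomogeneous d) (hred : Squarefree f) :
    (PlaneCurve.IsOfType f d (d - 1) 3 ↔ PlaneCurve.IsSmooth f) ∧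
      (PlaneCurve.IsSmooth f → PlaneCurve.IsKoszulGenerated f) := by
  refine ⟨⟨?_, PlaneCurve.isOfType_of_isSmooth (by omega) hf⟩,
    PlaneCurve.isKoszulGenerated_of_isSmooth (by omega) hf⟩
  rintro ⟨-, -, ρ, hρ⟩
  refine PlaneCurve.isSmooth_of_isKoszulGenerated (by omega) hf
    (PlaneCurve.isKoszulGenerated_of_isMinimalGenerators (by omega) hf hρ.homogeneous
      hρ.span_eq) fun v hv i => ?_
  exact PlaneCurve.mem_pow_idealOfVars_of_span_eq hρ.homogeneous hρ.span_eq hv i
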